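/- Let $N\ge 2$ be an integer and let $\mathbb T$ be the unit circle with normalized Haar measure $\mu$; for a function $m$ on $\mathbb T$ write $m(\omega)$ for its value at $z=e^{-i\omega}$. Let $m_0,m_0'\in L^\infty(\mathbb T)$, and let $\varphi,\varphi'\in L^2(\mathbb R)$ be compactly supported scaling functions with these filters, i.e. with $\widehat\psi(\omega)=\int_{\mathbb R}\psi(t)e^{-it\omega}\,dt$ (extended to $L^2(\mathbb R)$), $$\sqrt N\,\widehat{\varphi}(N\omega)=m_0(\omega)\widehat\varphi(\omega),\qquad \sqrt N\,\widehat{\varphi'}(N\omega)=m_0'(\omega)\widehat{\varphi'}(\omega)\qquad\text{for a.e. }\omega\in\mathbb R .$$ Suppose that $\varphi$ and $\varphi'$ are biorthogonal, i.e. $\int_{\mathbb R}\overline{\varphi(x-j)}\,\varphi'(x-k)\,dx=\delta_{jk}$ for all $j,k\in\mathbb Z$, and that $m_0,m_0'$ are continuous at the points $2k\pi/N$, $k=0,\dots,N-1$, with $$m_0(0)=m_0'(0)=\sqrt N,\qquad m_0\left(\tfrac{2k\pi}{N}\right)=m_0'\left(\tfrac{2k\pi}{N}\right)=0\quad (k=1,\dots,N-1).$$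 Define $$R_{m_0,m_0'}f(z)=\frac1N\sum_{w^N=z}\overline{m_0(w)}\,m_0'(w)\,f(w)\qquad(z\in\mathbb T).$$ Then, up to a multiplicative constant, the constant function $\mathbf 1$ is the only solution of $R_{m_0,m_0'}h_0=h_0$ in $L^\infty(\mathbb T)$ that is continuous at $z=1$: a function $h_0\in L^\infty(\mathbb T)$ that is continuous at $z=1$ satisfies $R_{m_0,m_0'}h_0=h_0$ $\mu$-a.e. if and only if $h_0$ is $\mu$-a.e. equal to a constant. -/

import Mathlib

open MeasureTheory Filter Topology
open scoped ENNReal FourierTransform ComplexConjugate Real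

noncomputable section

namespace BiorthogonalRuelle

/-- The circle group carries its Borel sigma-algebra. -/
instance : MeasurableSpace Circle := borel Circle

instance : BorelSpace Circle := ⟨rfl⟩

/-- The Haar measure on the unit circle, normalized to have total mass `1`. -/
def haarCircle : Measure Circle := Measure.haarMeasure ⊤

/-- The Hilbert space `L²(ℝ)` of complex valued functions; its inner product is conjugate linear
in the first variable. -/
abbrev L2R : Type := Lp ℂ 2 (volume : Measure ℝ)

/-- The value `m(ω)` of a function `m` on the circle at the frequency `ω`, i.e. at the point
`z = e^{-iω}`. -/
def atFreq (m : Circle → ℂ) (ω : ℝ) : ℂ := m (Circle.exp (-ω))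

/-- The rescaled function `x ↦ N^{-1/2} ψ(x/N)` is square integrable. -/
theorem memLp_dilation (N : ℕ) (ψ : L2R) :
    MemLp (fun x : ℝ => (((√(N : ℝ))⁻¹ : ℝ) : ℂ) * ψ (x / N)) 2 volume := by
  rcases Nat.eq_zero_or_pos N with rfl | hN
  · simp
  · have hN' : ((N : ℝ)⁻¹) ≠ 0 := by positivity
    have h1 : MemLp ψ 2 (Measure.map (fun x : ℝ => (N : ℝ)⁻¹ * x) volume) := by
      rw [Real.map_volume_mul_left hN']
      exact (Lp.memLp ψ).smul_measure ENNReal.ofReal_ne_top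
    have h2 := h1.comp_of_map (by fun_prop)
    have h3 : (ψ ∘ fun x : ℝ => (N : ℝ)⁻¹ * x) = fun x : ℝ => ψ (x / N) := by
      funext x
      simp [div_eq_inv_mul]
    rw [h3] at h2
    exact h2.const_mul _

/-- The dilation operator `U` of scale `N` on `L²(ℝ)`: `(Uψ)(x) = N^{-1/2} ψ(x/N)`. -/
def dilation (N : ℕ) (ψ : L2R) : L2R := (memLp_dilation N ψ).toLp _

/-- Integer translation on `L²(ℝ)`: `x ↦ ψ(x - k)`. -/
def translation (k : ℤ) (ψ : L2R) : L2R :=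
  Lp.compMeasurePreserving (fun x : ℝ => x - (k : ℝ)) (measurePreserving_sub_right volume (k : ℝ)) ψ

/-- `IsMultiplierImage f ψ η` says `η = π(f)ψ`, where `π(f)` is the operator on `L²(ℝ)` that
multiplies the Fourier transform `ψ̂(ω) = ∫ ψ(t) e^{-itω} dt` by `f(e^{-iω})`.  Mathlib's transform
`𝓕 ψ ξ` is `ψ̂(2πξ)`, so the frequency is `ω = 2πξ`. -/
def IsMultiplierImage (f : Circle → ℂ) (ψ η : L2R) : Prop :=
  ∀ᵐ ξ : ℝ, (𝓕 η : L2R) ξ = atFreq f (2 * π * ξ) * (𝓕 ψ : L2R) ξ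

/-- `φ ∈ L²(ℝ)` is a scaling function with filter `m ∈ L^∞(𝕋)` and scale `N`: it satisfies the
scaling equation `Uφ = π(m)φ`. -/
structure IsScalingFunction (N : ℕ) (m : Circle → ℂ) (φ : L2R) : Prop where
  filter_memLp : MemLp m ∞ haarCircle
  scaling : IsMultiplierImage m φ (dilation N φ)

/-- The class `φ ∈ L²(ℝ)` vanishes almost everywhere outside some compact set. -/
def IsCompactlySupported (φ : L2R) : Prop :=
  ∃ K : Set ℝ, IsCompact K ∧ ∀ᵐ x : ℝ, x ∉ K → φ x = 0

/-- Biorthogonality of the integer translates: `⟨φ(· - j), φ'(· - k)⟩ = δ_{jk}`. -/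
def Biorthogonal (φ φ' : L2R) : Prop :=
  ∀ j k : ℤ, inner ℂ (translation j φ) (translation k φ') = if j = k then (1 : ℂ) else 0

/-- The Ruelle transfer operator
`(R_{m,m'} f)(z) = (1/N) ∑_{w^N = z} conj(m(w)) m'(w) f(w)`. -/
def ruelle (N : ℕ) (m m' f : Circle → ℂ) (z : Circle) : ℂ :=
  (1 / (N : ℂ)) * ∑ᶠ w ∈ {w : Circle | w ^ N = z}, conj (m w) * m' w * f w

/-- The low-pass conditions on a filter of scale `N`: `m(0) = √N` and `m(2kπ/N) = 0` for
`k = 1, …, N-1`.  So that these point values are determined by the class of `m` in `L^∞(𝕋)`,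
`m` is continuous at the points where it is evaluated. -/
structure IsLowPass (N : ℕ) (m : Circle → ℂ) : Prop where
  continuousAt : ∀ k : ℕ, k < N → ContinuousAt m (Circle.exp (-(2 * k * π / N)))
  at_zero : atFreq m 0 = (√(N : ℝ) : ℝ)
  at_root : ∀ k : ℕ, 1 ≤ k → k < N → atFreq m (2 * k * π / N) = 0

end BiorthogonalRuelle

end

noncomputable section

namespace BiorthogonalRuelle

/-! ### Affine substitutions in `L²(ℝ)` and the Fourier transform -/

/-! Write points of the circle as e^{-2πit}, so that filters become functions M, M' of t in ℝ/ℤ, and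
let F, F' be the Fourier transforms of φ, φ'. Biorthogonality says that the ℤ-periodization of
conj(F)·F' is 1. It is used weakly, against bounded periodic test functions
(`integral_conj_mul_mul_periodic`). Combined with the two scaling equations and the substitution ξ ↦
Nξ, it gives R1 = 1 in weak form (`integral_comp_nsmul_mul_weight`), hence almost everywhere
(`ae_average_weight_eq_one`). This settles the constants.

For uniqueness, let h₀ be invariant and put H = h₀ - h₀(1), which is again invariant and tends to 0
along x/N^n. With P_n = ∏_{j<n} M(N^j t) and P'_n likewise, n uses of the duality between R and g ↦
g(N·) give ∫|H|² = ∫ conj(P_n) P'_n conj(H(N^n t)) H(t) dt. As H is bounded, this is at most a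
constant times ∫|H||P_n|² + ∫|H||P'_n|² (`ae_eq_zero_of_invariant`).

Both terms tend to 0 because of a lower bound ∫a ≤ C∫|F|²a for periodic a ≥ 0
(`exists_integral_le_integral_normSq_mul`). Iterated scaling turns ∫|F|²|H||P_n|² into
∫|F(x)|²|H(x/N^n)|dx, and dominated convergence applies. The lower bound for F follows from
biorthogonality and an upper bound for F'. That upper bound comes from compact support, which makes
the periodization of |F'|² a trigonometric polynomial. -/

theorem map_affine_volume {s : ℝ} (hs : 0 < s) (t : ℝ) :
    Measure.map (fun x : ℝ => s * x + t) volume = ENNReal.ofReal s⁻¹ • volume := by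
  have h : (fun x : ℝ => s * x + t) = (fun x => x + t) ∘ (fun x => s * x) := rfl
  rw [h, ← Measure.map_map (by fun_prop) (by fun_prop), Real.map_volume_mul_left hs.ne',
    Measure.map_smul, map_add_right_eq_self, abs_of_pos (inv_pos.2 hs)]

theorem quasiMeasurePreserving_affine {s : ℝ} (hs : 0 < s) (t : ℝ) :
    Measure.QuasiMeasurePreserving (fun x : ℝ => s * x + t) volume volume := by
  refine ⟨by fun_prop, ?_⟩
  rw [map_affine_volume hs t]
  exact Measure.smul_absolutelyContinuous

theorem memLp_weightedAffine {u : ℝ → ℂ} (hu : Measurable u) {K : ℝ} (hK : ∀ x, ‖u x‖ ≤ K)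
    {s : ℝ} (hs : 0 < s) (t : ℝ) {f : ℝ → ℂ} (hf : MemLp f 2 volume) :
    MemLp (fun x : ℝ => u x * f (s * x + t)) 2 volume := by
  have h1 : MemLp f 2 (Measure.map (fun x : ℝ => s * x + t) volume) := by
    rw [map_affine_volume hs]
    exact hf.smul_measure ENNReal.ofReal_ne_top
  have h2 := h1.comp_of_map (by fun_prop)
  refine h2.of_le_mul (c := K) (hu.aestronglyMeasurable.mul h2.1) (ae_of_all _ fun x => ?_)
  rw [norm_mul]
  exact mul_le_mul_of_nonneg_right (hK x) (norm_nonneg _)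

theorem eLpNorm_weightedAffine_le {u : ℝ → ℂ} {K : ℝ} (hK : ∀ x, ‖u x‖ ≤ K)
    {s : ℝ} (hs : 0 < s) (t : ℝ) {f : ℝ → ℂ} (hf : MemLp f 2 volume) :
    eLpNorm (fun x : ℝ => u x * f (s * x + t)) 2 volume ≤
      ENNReal.ofReal K * (ENNReal.ofReal s⁻¹ ^ (1 / 2 : ℝ) * eLpNorm f 2 volume) := by
  have h1 : eLpNorm (fun x : ℝ => f (s * x + t)) 2 volume =
      ENNReal.ofReal s⁻¹ ^ (1 / 2 : ℝ) * eLpNorm f 2 volume := by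
    have := eLpNorm_map_measure (p := 2) (μ := volume) (f := fun x : ℝ => s * x + t) (g := f)
      (by rw [map_affine_volume hs]; exact hf.1.smul_measure _) (by fun_prop)
    rw [map_affine_volume hs, eLpNorm_smul_measure_of_ne_top (by simp)] at this
    rw [show (fun x : ℝ => f (s * x + t)) = f ∘ fun x : ℝ => s * x + t from rfl, ← this]
    simp
  rw [← h1]
  refine eLpNorm_le_mul_eLpNorm_of_ae_le_mul (ae_of_all _ fun x => ?_) 2
  rw [norm_mul]
  exact mul_le_mul_of_nonneg_right (hK x) (norm_nonneg _)

/-- The bounded operator `f ↦ u · f(s · + t)` on `L²(ℝ)`. -/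
def weightedAffine {u : ℝ → ℂ} (hu : Measurable u) {K : ℝ} (hK : ∀ x, ‖u x‖ ≤ K)
    {s : ℝ} (hs : 0 < s) (t : ℝ) : L2R →L[ℂ] L2R :=
  LinearMap.mkContinuous
    { toFun := fun f => (memLp_weightedAffine hu hK hs t (Lp.memLp f)).toLp _
      map_add' := fun f g => by
        rw [← MemLp.toLp_add]
        refine MemLp.toLp_congr _ _ ?_
        filter_upwards [(quasiMeasurePreserving_affine hs t).ae_eq_comp (Lp.coeFn_add f g)]
          with x hx
        simp only [Function.comp_apply, Pi.add_apply] at hx ⊢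
        rw [hx, mul_add]
      map_smul' := fun c f => by
        rw [RingHom.id_apply, ← MemLp.toLp_const_smul]
        refine MemLp.toLp_congr _ _ ?_
        filter_upwards [(quasiMeasurePreserving_affine hs t).ae_eq_comp (Lp.coeFn_smul c f)]
          with x hx
        simp only [Function.comp_apply, Pi.smul_apply, smul_eq_mul] at hx ⊢
        rw [hx]; ring }
    ((ENNReal.ofReal K * ENNReal.ofReal s⁻¹ ^ (1 / 2 : ℝ)).toReal)
    (fun f => by
      simp only [LinearMap.coe_mk, AddHom.coe_mk, Lp.norm_toLp]
      rw [Lp.norm_def, ← ENNReal.toReal_mul, mul_assoc]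
      refine ENNReal.toReal_mono ?_ (eLpNorm_weightedAffine_le hK hs t (Lp.memLp f))
      exact ENNReal.mul_ne_top (by simp) (ENNReal.mul_ne_top (by simp) (Lp.eLpNorm_ne_top f)))

theorem coeFn_weightedAffine {u : ℝ → ℂ} (hu : Measurable u) {K : ℝ} (hK : ∀ x, ‖u x‖ ≤ K)
    {s : ℝ} (hs : 0 < s) (t : ℝ) (f : L2R) :
    weightedAffine hu hK hs t f =ᵐ[volume] fun x => u x * f (s * x + t) :=
  (memLp_weightedAffine hu hK hs t (Lp.memLp f)).coeFn_toLp

theorem fourier_affine (f : ℝ → ℂ) {s : ℝ} (hs : 0 < s) (t : ℝ) (c : ℂ) (ξ : ℝ) :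
    𝓕 (fun x : ℝ => c * f (s * x + t)) ξ =
      c * (s⁻¹ : ℝ) * Complex.exp (2 * π * Complex.I * (t / s * ξ : ℝ)) * 𝓕 f (s⁻¹ * ξ) := by
  simp only [Real.fourier_eq', RCLike.inner_apply, conj_trivial, smul_eq_mul]
  have key := Measure.integral_comp_mul_left (fun y : ℝ =>
    Complex.exp (↑(-2 * π * (ξ * ((y - t) / s))) * Complex.I) * (c * f y)) s
  have key2 := integral_add_right_eq_self (μ := volume) (fun y : ℝ =>
    Complex.exp (↑(-2 * π * (ξ * ((y - t) / s))) * Complex.I) * (c * f y)) t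
  have key3 := Measure.integral_comp_mul_left (fun y : ℝ =>
    Complex.exp (↑(-2 * π * (ξ * ((y + t - t) / s))) * Complex.I) * (c * f (y + t))) s
  calc _ = ∫ x : ℝ, Complex.exp (↑(-2 * π * (ξ * ((s * x + t - t) / s))) * Complex.I) *
        (c * f (s * x + t)) := by
        refine integral_congr_ae (ae_of_all _ fun x => ?_)
        simp only
        rw [add_sub_cancel_right, mul_div_cancel_left₀ _ hs.ne']
    _ = |s⁻¹| • ∫ y : ℝ,
        Complex.exp (↑(-2 * π * (ξ * ((y - t) / s))) * Complex.I) * (c * f y) := by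
        rw [key3, key2]
    _ = _ := by
        have h : ∀ y : ℝ, Complex.exp (↑(-2 * π * (ξ * ((y - t) / s))) * Complex.I) * (c * f y) =
            (c * Complex.exp (2 * π * Complex.I * (t / s * ξ : ℝ))) *
            (Complex.exp (↑(-2 * π * (y * (s⁻¹ * ξ))) * Complex.I) * f y) := fun y => by
          have : Complex.exp (↑(-2 * π * (ξ * ((y - t) / s))) * Complex.I) =
              Complex.exp (2 * π * Complex.I * (t / s * ξ : ℝ)) *
              Complex.exp (↑(-2 * π * (y * (s⁻¹ * ξ))) * Complex.I) := by
            rw [← Complex.exp_add]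
            congr 1
            push_cast
            field_simp
            ring
          rw [this]; ring
        rw [abs_of_pos (inv_pos.2 hs), Complex.real_smul, integral_congr_ae (ae_of_all _ h),
          integral_const_mul]
        simp only [mul_comm _ (s⁻¹ * ξ)]
        ring

/-- The Schwartz function `f(s · + t)`. -/
def schwartzAffine {s : ℝ} (hs : 0 < s) (t : ℝ) (f : SchwartzMap ℝ ℂ) : SchwartzMap ℝ ℂ :=
  SchwartzMap.compCLMOfContinuousLinearEquiv ℂ
    (ContinuousLinearEquiv.unitsEquivAut ℝ (Units.mk0 s hs.ne'))
    (SchwartzMap.compSubConstCLM ℂ (-t) f)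

theorem schwartzAffine_apply {s : ℝ} (hs : 0 < s) (t : ℝ) (f : SchwartzMap ℝ ℂ) (x : ℝ) :
    schwartzAffine hs t f x = f (s * x + t) := by
  simp [schwartzAffine, mul_comm]

theorem norm_fourierWeight_le {s : ℝ} (hs : 0 < s) (t : ℝ) (c : ℂ) (ξ : ℝ) :
    ‖c * (s⁻¹ : ℝ) * Complex.exp (2 * π * Complex.I * (t / s * ξ : ℝ))‖ ≤ ‖c‖ * s⁻¹ := by
  rw [norm_mul, norm_mul, show (2 * π * Complex.I * (t / s * ξ : ℝ) : ℂ) =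
    ((2 * π * (t / s * ξ) : ℝ) : ℂ) * Complex.I by push_cast; ring,
    Complex.norm_exp_ofReal_mul_I, mul_one, Complex.norm_real, Real.norm_eq_abs,
    abs_of_pos (inv_pos.2 hs)]

/-- Both sides are continuous in `f` and Schwartz functions are dense, so the integral formula
`fourier_affine` suffices. Translations and dilations are both special cases. -/
theorem fourier_weightedAffine {s : ℝ} (hs : 0 < s) (t : ℝ) (c : ℂ) (f : L2R) :
    (𝓕 (weightedAffine (u := fun _ => c) measurable_const (fun _ => le_rfl) hs t f) : L2R) =
      weightedAffine (u := fun ξ => c * (s⁻¹ : ℝ) * Complex.exp (2 * π * Complex.I * (t / s * ξ : ℝ)))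
        (by fun_prop) (norm_fourierWeight_le hs t c) (inv_pos.2 hs) 0 (𝓕 f : L2R) := by
  have hF : Continuous fun f : L2R => (𝓕 f : L2R) := (Lp.fourierTransformₗᵢ ℝ ℂ).continuous
  refine DenseRange.induction_on
    (SchwartzMap.denseRange_toLpCLM (p := 2) (μ := (volume : Measure ℝ)) (F := ℂ)
      ENNReal.ofNat_ne_top) f
    (isClosed_eq (hF.comp (ContinuousLinearMap.continuous _))
      ((ContinuousLinearMap.continuous _).comp hF)) ?_
  intro g
  rw [SchwartzMap.toLpCLM_apply, SchwartzMap.toLp_fourier_eq]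
  have h1 : weightedAffine (u := fun _ => c) measurable_const (fun _ => le_rfl) hs t (g.toLp 2) =
      (c • schwartzAffine hs t g).toLp 2 := by
    apply Lp.ext
    filter_upwards [coeFn_weightedAffine (u := fun _ => c) measurable_const (fun _ => le_rfl) hs t
      (g.toLp 2), (c • schwartzAffine hs t g).coeFn_toLp 2 volume,
      (quasiMeasurePreserving_affine hs t).ae_eq_comp (g.coeFn_toLp 2 volume)] with x h1 h2 h3
    simp only [Function.comp_apply] at h3
    rw [h1, h2, h3, smul_apply, schwartzAffine_apply, smul_eq_mul]
  rw [h1, SchwartzMap.toLp_fourier_eq]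
  apply Lp.ext
  refine (SchwartzMap.coeFn_toLp _ 2 volume).trans (EventuallyEq.trans ?_
    (coeFn_weightedAffine _ (norm_fourierWeight_le hs t c) (inv_pos.2 hs) 0 _).symm)
  filter_upwards [(quasiMeasurePreserving_affine (inv_pos.2 hs) 0).ae_eq_comp
    ((𝓕 g).coeFn_toLp 2 volume)] with ξ hξ
  simp only [Function.comp_apply] at hξ
  rw [hξ, SchwartzMap.fourier_coe, SchwartzMap.fourier_coe, add_zero, ← fourier_affine _ hs]
  refine congrArg (fun h : ℝ → ℂ => 𝓕 h ξ) (funext fun x => ?_)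
  simp [schwartzAffine_apply]

theorem fourier_translation (k : ℤ) (ψ : L2R) :
    (𝓕 (translation k ψ) : L2R) =ᵐ[volume]
      fun ξ => Complex.exp (2 * π * Complex.I * (-k * ξ : ℝ)) * (𝓕 ψ : L2R) ξ := by
  have h : translation k ψ = weightedAffine (u := fun _ => 1) measurable_const
      (fun _ => le_rfl) one_pos (-k) ψ := by
    apply Lp.ext
    filter_upwards [coeFn_weightedAffine (u := fun _ => 1) measurable_const (fun _ => le_rfl)
      one_pos (-k) ψ, Lp.coeFn_compMeasurePreserving ψ
      (measurePreserving_sub_right volume (k : ℝ))] with x h1 h2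
    rw [h1, translation, h2]
    simp [sub_eq_add_neg]
  rw [h, fourier_weightedAffine]
  refine (coeFn_weightedAffine _ (norm_fourierWeight_le one_pos _ _) _ 0 _).trans
    (Eventually.of_forall fun ξ => ?_)
  simp

theorem fourier_dilation {N : ℕ} (hN : 0 < N) (ψ : L2R) :
    (𝓕 (dilation N ψ) : L2R) =ᵐ[volume]
      fun ξ => ((√(N : ℝ) : ℝ) : ℂ) * (𝓕 ψ : L2R) (N * ξ) := by
  have hN' : (0 : ℝ) < (N : ℝ)⁻¹ := by positivity
  have h : dilation N ψ = weightedAffine (u := fun _ => (((√(N : ℝ))⁻¹ : ℝ) : ℂ)) measurable_const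
      (fun _ => le_rfl) hN' 0 ψ := by
    apply Lp.ext
    refine (MemLp.coeFn_toLp _).trans (EventuallyEq.trans ?_ (coeFn_weightedAffine _ _ _ _ _).symm)
    refine Eventually.of_forall fun x => ?_
    simp [div_eq_inv_mul]
  rw [h, fourier_weightedAffine]
  refine (coeFn_weightedAffine _ (norm_fourierWeight_le hN' _ _) _ 0 _).trans
    (Eventually.of_forall fun ξ => ?_)
  simp only [inv_inv, zero_div, zero_mul, Complex.ofReal_zero, mul_zero, Complex.exp_zero, mul_one,
    add_zero]
  rw [← Complex.ofReal_mul]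
  congr 2
  rw [inv_mul_eq_div, Real.div_sqrt]

/-! ### Integrals of periodic functions -/

/-- Lets an identity of integrals pass from trigonometric polynomials to continuous functions. The
map `e` will be either the quotient map from the line or the identity of the circle. -/
theorem continuous_integral_mul_comp {X : Type*} [MeasurableSpace X] {μ : Measure X} {f : X → ℂ}
    (hf : Integrable f μ) {e : X → UnitAddCircle} (he : Measurable e) :
    Continuous fun g : C(UnitAddCircle, ℂ) => ∫ x, f x * g (e x) ∂μ := by
  refine continuous_iff_continuousAt.2 fun g₀ => ?_
  refine continuousAt_of_dominated (bound := fun x => ‖f x‖ * (‖g₀‖ + 1))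
    (Eventually.of_forall fun g =>
      hf.1.mul (g.continuous.measurable.comp he).aestronglyMeasurable) ?_
    (hf.norm.mul_const _) (ae_of_all _ fun x => ?_)
  · have : ∀ᶠ g : C(UnitAddCircle, ℂ) in 𝓝 g₀, ‖g‖ < ‖g₀‖ + 1 :=
      continuous_norm.continuousAt.eventually_lt continuousAt_const (lt_add_one _)
    filter_upwards [this] with g hg
    refine ae_of_all _ fun x => ?_
    rw [norm_mul]
    exact mul_le_mul_of_nonneg_left ((g.norm_coe_le_norm _).trans hg.le) (norm_nonneg _)
  · exact (continuous_const.mul (continuous_eval_const (e x))).continuousAt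

/-- Controls the passage from continuous to bounded measurable test functions: the error is an L¹
distance for the push-forward of |f|dμ. -/
theorem enorm_integral_mul_comp_sub_le {X : Type*} [MeasurableSpace X] {μ : Measure X} {f : X → ℂ}
    (hf : Integrable f μ) {e : X → UnitAddCircle} (he : Measurable e) {g g' : UnitAddCircle → ℂ}
    (hg : Measurable g) (hg' : Measurable g') {K K' : ℝ} (hK : ∀ t, ‖g t‖ ≤ K)
    (hK' : ∀ t, ‖g' t‖ ≤ K') :
    ‖(∫ x, f x * g (e x) ∂μ) - ∫ x, f x * g' (e x) ∂μ‖ₑ ≤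
      ∫⁻ t, ‖g t - g' t‖ₑ ∂((μ.withDensity fun x => ‖f x‖ₑ).map e) := by
  have h1 : Integrable (fun x => f x * g (e x)) μ :=
    hf.mul_bdd (hg.comp he).aestronglyMeasurable (ae_of_all _ fun x => hK _)
  have h2 : Integrable (fun x => f x * g' (e x)) μ :=
    hf.mul_bdd (hg'.comp he).aestronglyMeasurable (ae_of_all _ fun x => hK' _)
  rw [← integral_sub h1 h2, lintegral_map (by fun_prop) he,
    lintegral_withDensity_eq_lintegral_mul₀ hf.1.enorm (by fun_prop)]
  refine (enorm_integral_le_lintegral_enorm _).trans (lintegral_mono fun x => ?_)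
  rw [← mul_sub, enorm_mul]
  rfl

/-- If an integrable function on the line and one on the circle have the same Fourier
coefficients, then they have the same integrals against all bounded periodic functions. -/
theorem integral_mul_periodic_eq {f : ℝ → ℂ} (hf : Integrable f volume) {p : UnitAddCircle → ℂ}
    (hp : Integrable p volume)
    (h : ∀ k : ℤ, ∫ x : ℝ, f x * fourier k (x : UnitAddCircle) = ∫ t, p t * fourier k t)
    {g : UnitAddCircle → ℂ} (hg : Measurable g) {K : ℝ} (hK : ∀ t, ‖g t‖ ≤ K) :
    ∫ x : ℝ, f x * g (x : UnitAddCircle) = ∫ t, p t * g t := by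
  have he : Measurable ((↑) : ℝ → UnitAddCircle) := AddCircle.measurable_mk'
  have hcont : ∀ g : C(UnitAddCircle, ℂ),
      ∫ x : ℝ, f x * g (x : UnitAddCircle) = ∫ t, p t * g t := by
    intro g
    -- For continuous `g`: trigonometric polynomials are uniformly dense, and the identity is a
    -- closed condition.
    have hmem : g ∈ (Submodule.span ℂ (Set.range (@fourier 1))).topologicalClosure := by
      rw [span_fourier_closure_eq_top]; trivial
    have hclosed : IsClosed {g : C(UnitAddCircle, ℂ) |
        ∫ x : ℝ, f x * g (x : UnitAddCircle) = ∫ t, p t * g t} :=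
      isClosed_eq (continuous_integral_mul_comp hf he)
        (continuous_integral_mul_comp hp measurable_id)
    refine closure_minimal ?_ hclosed hmem
    intro g hg
    have hi : ∀ g : C(UnitAddCircle, ℂ), Integrable (fun x : ℝ => f x * g (x : UnitAddCircle)) :=
      fun g => hf.mul_bdd (g.continuous.measurable.comp he).aestronglyMeasurable
        (ae_of_all _ fun x => g.norm_coe_le_norm _)
    have hi' : ∀ g : C(UnitAddCircle, ℂ), Integrable (fun t => p t * g t) :=
      fun g => hp.mul_bdd g.continuous.measurable.aestronglyMeasurable
        (ae_of_all _ fun x => g.norm_coe_le_norm _)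
    induction hg using Submodule.span_induction with
    | mem g hg => obtain ⟨k, rfl⟩ := hg; exact h k
    | zero => simp
    | add g₁ g₂ _ _ h₁ h₂ =>
      simp only [Set.mem_ofPred_eq, ContinuousMap.add_apply, mul_add] at h₁ h₂ ⊢
      rw [integral_add (hi g₁) (hi g₂), integral_add (hi' g₁) (hi' g₂), h₁, h₂]
    | smul c g _ h₁ =>
      simp only [Set.mem_ofPred_eq, ContinuousMap.smul_apply, smul_eq_mul, mul_left_comm _ c]
        at h₁ ⊢
      rw [integral_const_mul, integral_const_mul, h₁]
  have hfin : ∀ {X : Type} [MeasurableSpace X] {μ : Measure X} {f : X → ℂ}, Integrable f μ →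
      IsFiniteMeasure (μ.withDensity fun x => ‖f x‖ₑ) := fun hf =>
    isFiniteMeasure_withDensity hf.2.ne
  have := hfin hf
  have := hfin hp
  -- A single finite measure dominates the errors on the line and on the circle, so one continuous
  -- approximant `G` in L¹(ν) serves both sides.
  set ν : Measure UnitAddCircle := (volume.withDensity fun x => ‖f x‖ₑ).map (↑) +
    (volume.withDensity fun t => ‖p t‖ₑ).map id with hν
  have hgν : Integrable g ν :=
    Integrable.of_bound hg.aestronglyMeasurable K (ae_of_all _ hK)
  rw [← sub_eq_zero, ← enorm_eq_zero, ← nonpos_iff_eq_zero]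
  refine le_of_forall_pos_le_add fun ε hε => ?_
  obtain ⟨G, hG, -⟩ := hgν.exists_boundedContinuous_lintegral_sub_le hε.ne'
  have h1 := enorm_integral_mul_comp_sub_le hf he hg G.continuous.measurable hK G.norm_coe_le_norm
  have h2 := enorm_integral_mul_comp_sub_le hp measurable_id G.continuous.measurable hg
    G.norm_coe_le_norm hK
  have h3 := hcont G.toContinuousMap
  simp only [BoundedContinuousFunction.coe_toContinuousMap] at h3
  simp only [enorm_sub_rev (G _)] at h2
  rw [hν, lintegral_add_measure] at hG
  calc _ = ‖((∫ x : ℝ, f x * g (x : UnitAddCircle)) - ∫ x : ℝ, f x * G (x : UnitAddCircle)) +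
        ((∫ t, p t * G (id t)) - ∫ t, p t * g (id t))‖ₑ := by
        simp only [id]; rw [h3]; congr 1; ring
    _ ≤ _ := (enorm_add_le _ _).trans ((add_le_add h1 h2).trans (by rwa [zero_add]))

theorem quasiMeasurePreserving_unitAddCircle_mk :
    Measure.QuasiMeasurePreserving ((↑) : ℝ → UnitAddCircle) volume volume := by
  refine ⟨AddCircle.measurable_mk', Measure.AbsolutelyContinuous.mk fun s hs h0 => ?_⟩
  rw [Measure.map_apply AddCircle.measurable_mk' hs]
  have h : ∀ n : ℤ, volume (((↑) : ℝ → UnitAddCircle) ⁻¹' s ∩ Set.Ioc (n : ℝ) (n + 1)) = 0 := by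
    intro n
    have := (UnitAddCircle.measurePreserving_mk (n : ℝ)).measure_preimage hs.nullMeasurableSet
    rwa [h0, Measure.restrict_apply (AddCircle.measurable_mk' hs)] at this
  refine measure_mono_null ?_ (measure_iUnion_null h)
  intro x hx
  have : x ∈ ⋃ n : ℤ, Set.Ioc (n : ℝ) (n + 1) := by rw [iUnion_Ioc_intCast]; trivial
  obtain ⟨n, hn⟩ := Set.mem_iUnion.1 this
  exact Set.mem_iUnion.2 ⟨n, hx, hn⟩

/-- The duality between g ↦ g(N·) and averaging over the N preimages: substitute y = Nt, cut [0, N]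
into unit intervals, and use that `g` has period 1. -/
theorem integral_comp_nsmul_mul {N : ℕ} (hN : 0 < N) {g V : UnitAddCircle → ℂ} (hg : Measurable g)
    (hV : Measurable V) {K : ℝ} (hK : ∀ t, ‖g t‖ ≤ K) (hK' : ∀ t, ‖V t‖ ≤ K) :
    ∫ t, g (N • t) * V t = ∫ x in (0 : ℝ)..1, g (x : UnitAddCircle) *
      ((1 / (N : ℂ)) * ∑ l ∈ Finset.range N, V (((x + l) / N : ℝ) : UnitAddCircle)) := by
  have hN' : (N : ℝ) ≠ 0 := by positivity
  have he : Measurable ((↑) : ℝ → UnitAddCircle) := AddCircle.measurable_mk'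
  have hK0 : 0 ≤ K := (norm_nonneg _).trans (hK 0)
  set f : ℝ → ℂ := fun y => g (y : UnitAddCircle) * V ((y / N : ℝ) : UnitAddCircle) with hf
  have hfm : Measurable f := by
    exact (hg.comp he).mul (hV.comp (he.comp (by fun_prop)))
  have hfb : ∀ y, ‖f y‖ ≤ K * K := fun y => by
    rw [hf, norm_mul]
    exact mul_le_mul (hK _) (hK' _) (norm_nonneg _) hK0
  have hfi : ∀ a b : ℝ, IntervalIntegrable f volume a b := fun a b =>
    (intervalIntegrable_const (c := K * K)).mono_fun hfm.aestronglyMeasurable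
      (ae_of_all _ fun y => (hfb y).trans (le_abs_self _))
  have h1 : ∫ t, g (N • t) * V t = (N : ℝ)⁻¹ • ∫ y in (0 : ℝ)..N, f y := by
    have h := intervalIntegral.integral_comp_mul_left (a := 0) (b := 1) f hN'
    rw [mul_zero, mul_one] at h
    rw [← h]
    have := UnitAddCircle.intervalIntegral_preimage 0 (fun t => g (N • t) * V t)
    rw [zero_add] at this
    rw [← this]
    refine intervalIntegral.integral_congr fun x _ => ?_
    simp only [hf]
    rw [mul_div_cancel_left₀ _ hN', ← nsmul_eq_mul, AddCircle.coe_nsmul]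
  have h2 : ∫ y in (0 : ℝ)..N, f y = ∑ l ∈ Finset.range N, ∫ y in (0 : ℝ)..1, f (y + l) := by
    have := intervalIntegral.sum_integral_adjacent_intervals (f := f) (a := fun l : ℕ => (l : ℝ))
      (n := N) (μ := volume) fun k _ => hfi _ _
    rw [Nat.cast_zero] at this
    rw [← this]
    refine Finset.sum_congr rfl fun l _ => ?_
    rw [intervalIntegral.integral_comp_add_right, zero_add, Nat.cast_succ, add_comm (1 : ℝ)]
  rw [h1, h2, ← intervalIntegral.integral_finsetSum, ← intervalIntegral.integral_smul]
  · refine intervalIntegral.integral_congr fun x _ => ?_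
    simp only [hf, Complex.real_smul]
    rw [Finset.mul_sum, Finset.mul_sum, Finset.mul_sum]
    refine Finset.sum_congr rfl fun l _ => ?_
    have : ((x + l : ℝ) : UnitAddCircle) = x := by
      rw [AddCircle.coe_add, add_eq_left]
      exact (AddCircle.coe_eq_zero_iff 1).2 ⟨l, by simp⟩
    rw [this]
    push_cast
    ring
  · intro l _
    exact (intervalIntegrable_const (c := K * K)).mono_fun
      (hfm.comp (measurable_id.add_const _)).aestronglyMeasurable
      (ae_of_all _ fun y => (hfb _).trans (le_abs_self _))

/-! ### Iterated filters and the uniqueness argument -/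

/-- The iterated filter `∏_{j < n} M(N^j t)`. -/
def filterProd (N : ℕ) (M : UnitAddCircle → ℂ) (n : ℕ) (t : UnitAddCircle) : ℂ :=
  ∏ j ∈ Finset.range n, M (N ^ j • t)

theorem filterProd_succ (N : ℕ) (M : UnitAddCircle → ℂ) (n : ℕ) (t : UnitAddCircle) :
    filterProd N M (n + 1) t = filterProd N M n (N • t) * M t := by
  rw [filterProd, Finset.prod_range_succ', filterProd]
  simp [pow_succ, mul_smul]

theorem measurable_filterProd (N : ℕ) {M : UnitAddCircle → ℂ} (hM : Measurable M) (n : ℕ) :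
    Measurable (filterProd N M n) :=
  Finset.measurable_fun_prod _ fun _ _ => hM.comp (continuous_nsmul _).measurable

theorem norm_filterProd_le (N : ℕ) {M : UnitAddCircle → ℂ} {K : ℝ} (hK : ∀ t, ‖M t‖ ≤ K) (n : ℕ)
    (t : UnitAddCircle) : ‖filterProd N M n t‖ ≤ K ^ n := by
  rw [filterProd, norm_prod]
  exact (Finset.prod_le_prod (fun _ _ => norm_nonneg _) fun _ _ => hK _).trans_eq (by simp)

theorem ae_filterProd_mul_eq {N : ℕ} (hN : 0 < N) {M : UnitAddCircle → ℂ} {F : ℝ → ℂ}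
    (h : ∀ᵐ ξ : ℝ, ((√(N : ℝ) : ℝ) : ℂ) * F (N * ξ) = M (ξ : UnitAddCircle) * F ξ) (n : ℕ) :
    ∀ᵐ ξ : ℝ, ((√(N : ℝ) : ℝ) : ℂ) ^ n * F ((N : ℝ) ^ n * ξ) =
      filterProd N M n (ξ : UnitAddCircle) * F ξ := by
  induction n with
  | zero => simp [filterProd]
  | succ n ih =>
    filter_upwards [h, (quasiMeasurePreserving_affine (s := N) (by positivity) 0).ae ih]
      with ξ h1 h2
    simp only [add_zero] at h2
    have h3 : (((N * ξ : ℝ)) : UnitAddCircle) = N • (ξ : UnitAddCircle) := by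
      rw [← nsmul_eq_mul, AddCircle.coe_nsmul]
    rw [filterProd_succ, ← h3, mul_assoc, ← h1, mul_left_comm, ← h2, pow_succ, pow_succ, ← mul_assoc,
      mul_assoc (_ ^ n : ℝ)]
    ring

/-- The lower bound `hlow` moves the integral to the line with weight |F|². There the iterated
filter is absorbed by rescaling, and only H(x/N^n) still depends on n. -/
theorem tendsto_integral_norm_mul_filterProd {N : ℕ} (hN : 2 ≤ N) {M H : UnitAddCircle → ℂ}
    (hM : Measurable M) (hH : Measurable H) {K : ℝ} (hMK : ∀ t, ‖M t‖ ≤ K) (hHK : ∀ t, ‖H t‖ ≤ K)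
    {F : ℝ → ℂ} (hF : MemLp F 2 volume)
    (hscal : ∀ᵐ ξ : ℝ, ((√(N : ℝ) : ℝ) : ℂ) * F (N * ξ) = M (ξ : UnitAddCircle) * F ξ)
    {C : ℝ} (hlow : ∀ a : UnitAddCircle → ℝ, Measurable a → (∀ t, 0 ≤ a t) →
      (∃ B : ℝ, ∀ t, a t ≤ B) → ∫ t, a t ≤ C * ∫ x : ℝ, ‖F x‖ ^ 2 * a (x : UnitAddCircle))
    (hlim : ∀ᵐ x : ℝ, Tendsto (fun n : ℕ => H ((x / (N : ℝ) ^ n : ℝ) : UnitAddCircle)) atTop (𝓝 0)) :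
    Tendsto (fun n : ℕ => ∫ t, ‖H t‖ * ‖filterProd N M n t‖ ^ 2) atTop (𝓝 0) := by
  have he : Measurable ((↑) : ℝ → UnitAddCircle) := AddCircle.measurable_mk'
  have hF2 : Integrable (fun x => ‖F x‖ ^ 2) volume := (memLp_two_iff_integrable_sq_norm hF.1).1 hF
  have hpow : ∀ n : ℕ, (N : ℝ) ^ n ≠ 0 := fun n => by positivity
  -- Substitution x = N^n ξ: the Jacobian N^n is exactly the squared factor (√N)^n of the iterated
  -- scaling equation.
  have key : ∀ n : ℕ, ∫ x : ℝ, ‖F x‖ ^ 2 * (‖H x‖ * ‖filterProd N M n x‖ ^ 2) =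
      ∫ x : ℝ, ‖F x‖ ^ 2 * ‖H ((x / (N : ℝ) ^ n : ℝ) : UnitAddCircle)‖ := by
    intro n
    have h1 := Measure.integral_comp_mul_left
      (fun x : ℝ => ‖F x‖ ^ 2 * ‖H ((x / (N : ℝ) ^ n : ℝ) : UnitAddCircle)‖) ((N : ℝ) ^ n)
    rw [abs_of_pos (by positivity), smul_eq_mul, eq_inv_mul_iff_mul_eq₀ (hpow n)] at h1
    rw [← h1, ← integral_const_mul]
    refine integral_congr_ae ?_
    filter_upwards [ae_filterProd_mul_eq (by lia) hscal n] with ξ hξ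
    have h2 := congrArg (fun z : ℂ => ‖z‖ ^ 2) hξ
    simp only [norm_mul, norm_pow, Complex.norm_real, Real.norm_eq_abs,
      abs_of_nonneg (Real.sqrt_nonneg _), mul_pow] at h2
    rw [← pow_mul, mul_comm n, pow_mul, Real.sq_sqrt (by positivity)] at h2
    rw [mul_div_cancel_left₀ _ (hpow n)]
    linear_combination -‖H (ξ : UnitAddCircle)‖ * h2
  have hdct : Tendsto (fun n : ℕ => ∫ x : ℝ, ‖F x‖ ^ 2 *
      ‖H ((x / (N : ℝ) ^ n : ℝ) : UnitAddCircle)‖) atTop (𝓝 (∫ _ : ℝ, (0 : ℝ))) := by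
    refine tendsto_integral_of_dominated_convergence (fun x => ‖F x‖ ^ 2 * K) (fun n => ?_)
      (hF2.mul_const K) (fun n => ae_of_all _ fun x => ?_) ?_
    · exact hF2.1.mul (hH.norm.comp (he.comp (by fun_prop))).aestronglyMeasurable
    · rw [norm_mul, norm_norm, norm_pow, norm_norm]
      exact mul_le_mul_of_nonneg_left (hHK _) (by positivity)
    · filter_upwards [hlim] with x hx
      simpa using hx.norm.const_mul (‖F x‖ ^ 2)
  rw [integral_zero] at hdct
  refine squeeze_zero (fun n => integral_nonneg fun t => by positivity) (fun n => ?_)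
    (by simpa using hdct.const_mul C)
  rw [← key n]
  have hK0 : 0 ≤ K := (norm_nonneg _).trans (hMK 0)
  refine hlow _ (hH.norm.mul ((measurable_filterProd N hM n).norm.pow_const 2))
    (fun t => by positivity) ⟨K * (K ^ n) ^ 2, fun t => ?_⟩
  gcongr
  · exact hHK t
  · exact norm_filterProd_le N hMK n t

/-- Here `hinv` is the weak form of RH = H. Iterating it writes the squared L² norm of `H` as
integrals that tend to 0. -/
theorem ae_eq_zero_of_invariant {N : ℕ} (hN : 2 ≤ N) {M M' H : UnitAddCircle → ℂ}
    (hM : Measurable M) (hM' : Measurable M') (hH : Measurable H) {K : ℝ} (hMK : ∀ t, ‖M t‖ ≤ K)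
    (hMK' : ∀ t, ‖M' t‖ ≤ K) (hHK : ∀ t, ‖H t‖ ≤ K)
    {F F' : ℝ → ℂ} (hF : MemLp F 2 volume) (hF' : MemLp F' 2 volume)
    (hscal : ∀ᵐ ξ : ℝ, ((√(N : ℝ) : ℝ) : ℂ) * F (N * ξ) = M (ξ : UnitAddCircle) * F ξ)
    (hscal' : ∀ᵐ ξ : ℝ, ((√(N : ℝ) : ℝ) : ℂ) * F' (N * ξ) = M' (ξ : UnitAddCircle) * F' ξ)
    {C : ℝ} (hlow : ∀ a : UnitAddCircle → ℝ, Measurable a → (∀ t, 0 ≤ a t) →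
      (∃ B : ℝ, ∀ t, a t ≤ B) → ∫ t, a t ≤ C * ∫ x : ℝ, ‖F x‖ ^ 2 * a (x : UnitAddCircle))
    {C' : ℝ} (hlow' : ∀ a : UnitAddCircle → ℝ, Measurable a → (∀ t, 0 ≤ a t) →
      (∃ B : ℝ, ∀ t, a t ≤ B) → ∫ t, a t ≤ C' * ∫ x : ℝ, ‖F' x‖ ^ 2 * a (x : UnitAddCircle))
    (hlim : ∀ᵐ x : ℝ, Tendsto (fun n : ℕ => H ((x / (N : ℝ) ^ n : ℝ) : UnitAddCircle)) atTop (𝓝 0))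
    (hinv : ∀ g : UnitAddCircle → ℂ, Measurable g → (∃ B : ℝ, ∀ t, ‖g t‖ ≤ B) →
      ∫ t, g (N • t) * (conj (M t) * M' t * H t) = ∫ t, g t * H t) :
    H =ᵐ[volume] 0 := by
  have hK0 : 0 ≤ K := (norm_nonneg _).trans (hMK 0)
  have hP := measurable_filterProd N hM
  have hP' := measurable_filterProd N hM'
  have hconj : Measurable (fun z : ℂ => conj z) := Complex.continuous_conj.measurable
  have hI : ∀ n : ℕ, ∫ t, conj (filterProd N M n t) * filterProd N M' n t *
      conj (H (N ^ n • t)) * H t = ∫ t, conj (H t) * H t := by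
    intro n
    induction n with
    | zero => simp [filterProd]
    | succ n ih =>
      -- The test function is the n-th integrand without its last factor H(t). Composing it with t ↦
      -- Nt and multiplying by conj(M)M' produces the products of length n + 1.
      rw [← ih, ← hinv (fun t => conj (filterProd N M n t) * filterProd N M' n t *
        conj (H (N ^ n • t)))]
      · refine integral_congr_ae (ae_of_all _ fun t => ?_)
        simp only [filterProd_succ, pow_succ, mul_smul, map_mul]
        ring
      · exact ((hconj.comp (hP n)).mul (hP' n)).mul
          (hconj.comp (hH.comp (continuous_nsmul _).measurable))
      · refine ⟨K ^ n * K ^ n * K, fun t => ?_⟩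
        simp only [norm_mul, RCLike.norm_conj]
        gcongr
        · exact norm_filterProd_le N hMK n t
        · exact norm_filterProd_le N hMK' n t
        · exact hHK _
  have hJ := tendsto_integral_norm_mul_filterProd hN hM hH hMK hHK hF hscal hlow hlim
  have hJ' := tendsto_integral_norm_mul_filterProd hN hM' hH hMK' hHK hF' hscal' hlow' hlim
  have hint : ∀ (M : UnitAddCircle → ℂ) (_ : Measurable M) (_ : ∀ t, ‖M t‖ ≤ K) (n : ℕ),
      Integrable (fun t => ‖H t‖ * ‖filterProd N M n t‖ ^ 2) volume := by
    intro M hM hMK n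
    refine Integrable.of_bound
      (hH.norm.mul ((measurable_filterProd N hM n).norm.pow_const 2)).aestronglyMeasurable
      (K * (K ^ n) ^ 2) (ae_of_all _ fun t => ?_)
    rw [Real.norm_of_nonneg (by positivity)]
    gcongr
    · exact hHK t
    · exact norm_filterProd_le N hMK n t
  -- The factor H(N^n t) is bounded by `K`, while H(t) is kept because it supplies the decay. The
  -- product |P_n||P'_n| is split by the arithmetic-geometric mean inequality.
  have hbound : ∀ n : ℕ, ‖∫ t, conj (H t) * H t‖ ≤ K / 2 *
      ((∫ t, ‖H t‖ * ‖filterProd N M n t‖ ^ 2) + ∫ t, ‖H t‖ * ‖filterProd N M' n t‖ ^ 2) := by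
    intro n
    rw [← hI n, ← integral_add (hint M hM hMK n) (hint M' hM' hMK' n), ← integral_const_mul]
    refine norm_integral_le_of_norm_le
      (((hint M hM hMK n).add (hint M' hM' hMK' n)).const_mul _) (ae_of_all _ fun t => ?_)
    simp only [norm_mul, RCLike.norm_conj]
    have h1 := two_mul_le_add_sq ‖filterProd N M n t‖ ‖filterProd N M' n t‖
    have h2 : ‖filterProd N M n t‖ * ‖filterProd N M' n t‖ ≤
        (‖filterProd N M n t‖ ^ 2 + ‖filterProd N M' n t‖ ^ 2) / 2 := by linarith
    calc _ ≤ (‖filterProd N M n t‖ ^ 2 + ‖filterProd N M' n t‖ ^ 2) / 2 * K * ‖H t‖ := by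
          gcongr
          exact hHK _
      _ = _ := by ring
  have hzero : ‖∫ t, conj (H t) * H t‖ ≤ 0 :=
    ge_of_tendsto' (by simpa using (hJ.add hJ').const_mul (K / 2)) hbound
  have hsq : ∫ t, ‖H t‖ ^ 2 = 0 := by
    have h1 : ∫ t, conj (H t) * H t = ((∫ t, ‖H t‖ ^ 2 : ℝ) : ℂ) := by
      refine Eq.trans ?_ integral_ofReal
      refine integral_congr_ae (ae_of_all _ fun t => ?_)
      simp [Complex.conj_mul']
    rw [h1, norm_le_zero_iff] at hzero
    exact_mod_cast hzero
  rw [integral_eq_zero_iff_of_nonneg (fun t => by positivity)] at hsq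
  · filter_upwards [hsq] with t ht
    simpa using ht
  · refine Integrable.of_bound (hH.norm.pow_const 2).aestronglyMeasurable (K ^ 2)
      (ae_of_all _ fun t => ?_)
    rw [Real.norm_of_nonneg (by positivity)]
    gcongr
    exact hHK t

/-! ### Consequences of biorthogonality and of compact support -/

theorem translation_zero (ψ : L2R) : translation 0 ψ = ψ := by
  apply Lp.ext
  refine (Lp.coeFn_compMeasurePreserving ψ (measurePreserving_sub_right volume _)).trans
    (Eventually.of_forall fun x => ?_)
  simp

theorem integrable_conj_mul (f g : L2R) : Integrable (fun x => conj (f x) * g x) volume := by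
  refine (L2.integrable_inner (𝕜 := ℂ) f g).congr (Eventually.of_forall fun x => ?_)
  simp [mul_comm]

/-- Plancherel: the Fourier coefficients of the periodization of conj(ψ̂)η̂ are inner products with
integer translates. -/
theorem integral_fourier_mul_fourier (ψ η : L2R) (k : ℤ) :
    ∫ ξ : ℝ, conj ((𝓕 ψ : L2R) ξ) * (𝓕 η : L2R) ξ * fourier (-k) (ξ : UnitAddCircle) =
      inner ℂ ψ (translation k η) := by
  rw [← Lp.inner_fourier_eq, L2.inner_def]
  refine integral_congr_ae ?_
  filter_upwards [fourier_translation k η] with ξ hξ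
  rw [hξ, RCLike.inner_apply, fourier_coe_apply]
  push_cast
  rw [show 2 * (π : ℂ) * Complex.I * -k * ξ / 1 = 2 * π * Complex.I * (-k * ξ) by ring]
  ring

theorem norm_fourier_apply (k : ℤ) (t : UnitAddCircle) : ‖fourier k t‖ = 1 := by
  rw [fourier_apply]
  exact Circle.norm_coe _

theorem integral_fourier (k : ℤ) :
    ∫ t : UnitAddCircle, fourier k t = if k = 0 then (1 : ℂ) else 0 := by
  have h := congrFun (fourierCoeff_fourier (T := 1) 0) (-k)
  rw [fourierCoeff, AddCircle.integral_haarAddCircle] at h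
  simp only [neg_neg, fourier_zero, smul_eq_mul, mul_one, inv_one, one_smul] at h
  rw [h]
  simp [Pi.single_apply]

/-- By biorthogonality, the periodization of conj(φ̂)φ̂' has the Fourier coefficients of the
constant 1. -/
theorem integral_conj_mul_mul_periodic {φ φ' : L2R} (hbi : Biorthogonal φ φ')
    {g : UnitAddCircle → ℂ} (hg : Measurable g) {K : ℝ} (hK : ∀ t, ‖g t‖ ≤ K) :
    ∫ ξ : ℝ, conj ((𝓕 φ : L2R) ξ) * (𝓕 φ' : L2R) ξ * g (ξ : UnitAddCircle) = ∫ t, g t := by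
  have h := integral_mul_periodic_eq (integrable_conj_mul (𝓕 φ : L2R) (𝓕 φ' : L2R))
    (p := fun _ => 1) (integrable_const _) (fun k => ?_) hg hK
  · simpa using h
  · have h1 := integral_fourier_mul_fourier φ φ' (-k)
    rw [neg_neg] at h1
    have h2 := hbi 0 (-k)
    rw [translation_zero] at h2
    simp only [one_mul]
    rw [h1, h2, integral_fourier]
    simp [eq_comm]

theorem exists_inner_translation_eq_zero {φ : L2R} (h : IsCompactlySupported φ) :
    ∃ L : ℕ, ∀ k : ℤ, k ∉ Finset.Icc (-(L : ℤ)) L → inner ℂ φ (translation k φ) = 0 := by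
  obtain ⟨K, hK, hφ⟩ := h
  obtain ⟨r, hr⟩ := hK.isBounded.exists_norm_le
  -- Two points of a set contained in [-r, r] differ by at most 2r, so larger shifts separate the
  -- supports.
  obtain ⟨L, hL⟩ := exists_nat_ge (2 * r)
  refine ⟨L, fun k hk => ?_⟩
  rw [L2.inner_def]
  refine integral_eq_zero_of_ae ?_
  have hφk := (measurePreserving_sub_right (volume : Measure ℝ) (k : ℝ)).quasiMeasurePreserving.ae hφ
  filter_upwards [hφ, hφk, Lp.coeFn_compMeasurePreserving φ
    (measurePreserving_sub_right volume (k : ℝ))] with x h1 h2 h3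
  rw [translation, h3, RCLike.inner_apply, Function.comp_apply, Pi.zero_apply]
  by_cases hx : x ∈ K
  · rw [h2, zero_mul]
    intro hx'
    apply hk
    have h4 := abs_le.1 (hr x hx)
    have h5 := abs_le.1 (hr _ hx')
    rw [Finset.mem_Icc]
    constructor
    · have : (-(L : ℝ)) ≤ k := by linarith
      exact_mod_cast this
    · have : (k : ℝ) ≤ L := by linarith
      exact_mod_cast this
  · rw [h1 hx, map_zero, mul_zero]

/-- Only finitely many autocorrelations ⟨φ, φ(· - k)⟩ are nonzero, so the periodization of |φ̂|² is
the trigonometric polynomial `p`, which is bounded. -/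
theorem exists_integral_normSq_mul_le {φ : L2R} (h : IsCompactlySupported φ) :
    ∃ C : ℝ, 0 < C ∧ ∀ a : UnitAddCircle → ℝ, Measurable a → (∀ t, 0 ≤ a t) →
      (∃ B : ℝ, ∀ t, a t ≤ B) →
      ∫ ξ : ℝ, ‖(𝓕 φ : L2R) ξ‖ ^ 2 * a (ξ : UnitAddCircle) ≤ C * ∫ t, a t := by
  obtain ⟨L, hL⟩ := exists_inner_translation_eq_zero h
  set c : ℤ → ℂ := fun k => inner ℂ φ (translation k φ) with hc
  set S : Finset ℤ := Finset.Icc (-(L : ℤ)) L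
  set p : UnitAddCircle → ℂ := fun t => ∑ k ∈ S, c k * fourier k t with hp
  have hpc : Continuous p := continuous_finsetSum _ fun k _ => continuous_const.mul (fourier k).2
  have hpb : ∀ t, ‖p t‖ ≤ 1 + ∑ k ∈ S, ‖c k‖ := fun t => by
    refine (norm_sum_le _ _).trans ((Finset.sum_le_sum fun k _ => ?_).trans
      (le_add_of_nonneg_left zero_le_one))
    rw [norm_mul]
    exact mul_le_of_le_one_right (norm_nonneg _) (norm_fourier_apply k t).le
  -- The added 1 makes the constant strictly positive, as needed when it is inverted later.
  refine ⟨1 + ∑ k ∈ S, ‖c k‖, by positivity, fun a ha ha0 ⟨B, hB⟩ => ?_⟩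
  have haB : ∀ t, ‖(a t : ℂ)‖ ≤ B := fun t => by
    rw [Complex.norm_real, Real.norm_of_nonneg (ha0 t)]; exact hB t
  have key := integral_mul_periodic_eq (integrable_conj_mul (𝓕 φ : L2R) (𝓕 φ : L2R))
    (p := p) (Integrable.of_bound hpc.aestronglyMeasurable _ (ae_of_all _ hpb)) (fun j => ?_)
    (g := fun t => (a t : ℂ)) (Complex.measurable_ofReal.comp ha) haB
  · have h1 : ∫ ξ : ℝ, conj ((𝓕 φ : L2R) ξ) * (𝓕 φ : L2R) ξ * (a (ξ : UnitAddCircle) : ℂ) =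
        ((∫ ξ : ℝ, ‖(𝓕 φ : L2R) ξ‖ ^ 2 * a (ξ : UnitAddCircle) : ℝ) : ℂ) := by
      refine Eq.trans ?_ integral_ofReal
      refine integral_congr_ae (ae_of_all _ fun ξ => ?_)
      simp [Complex.conj_mul']
    rw [h1] at key
    have h2 : ∫ ξ : ℝ, ‖(𝓕 φ : L2R) ξ‖ ^ 2 * a (ξ : UnitAddCircle) = ‖∫ t, p t * (a t : ℂ)‖ := by
      rw [← key, Complex.norm_real, Real.norm_of_nonneg]
      exact integral_nonneg fun ξ => mul_nonneg (by positivity) (ha0 _)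
    rw [h2, ← integral_const_mul]
    refine norm_integral_le_of_norm_le ((Integrable.of_bound ha.aestronglyMeasurable B
      (ae_of_all _ fun t => ?_)).const_mul _) (ae_of_all _ fun t => ?_)
    · rw [Real.norm_of_nonneg (ha0 t)]; exact hB t
    · rw [norm_mul, Complex.norm_real, Real.norm_of_nonneg (ha0 t)]
      exact mul_le_mul_of_nonneg_right (hpb t) (ha0 t)
  · have h1 := integral_fourier_mul_fourier φ φ (-j)
    rw [neg_neg] at h1
    rw [h1]
    have h2 : ∀ t : UnitAddCircle, p t * fourier j t = ∑ k ∈ S, c k * fourier (k + j) t := fun t => by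
      rw [hp, Finset.sum_mul]
      refine Finset.sum_congr rfl fun k _ => ?_
      rw [fourier_add, mul_assoc]
    simp only [h2]
    rw [integral_finsetSum]
    · simp only [integral_const_mul, integral_fourier, add_eq_zero_iff_eq_neg, mul_ite, mul_one,
        mul_zero, Finset.sum_ite_eq']
      split_ifs with hj
      · rfl
      · exact hL _ hj
    · intro k _
      exact Integrable.of_bound
        (continuous_const.mul (fourier (k + j)).2).aestronglyMeasurable ‖c k‖
        (ae_of_all _ fun t => by rw [norm_mul, norm_fourier_apply, mul_one])

/-- Biorthogonality gives ∫a = ∫conj(φ̂)φ̂'a. The inequality uv ≤ (C/2)u² + v²/(2C), with C the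
upper bound for φ', makes the second term at most half of ∫a, which is then absorbed on the left. -/
theorem exists_integral_le_integral_normSq_mul {φ φ' : L2R} (hbi : Biorthogonal φ φ')
    (h : IsCompactlySupported φ') :
    ∃ C : ℝ, ∀ a : UnitAddCircle → ℝ, Measurable a → (∀ t, 0 ≤ a t) → (∃ B : ℝ, ∀ t, a t ≤ B) →
      ∫ t, a t ≤ C * ∫ ξ : ℝ, ‖(𝓕 φ : L2R) ξ‖ ^ 2 * a (ξ : UnitAddCircle) := by
  obtain ⟨C, hC0, hC⟩ := exists_integral_normSq_mul_le h
  refine ⟨C, fun a ha ha0 ⟨B, hB⟩ => ?_⟩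
  have haB : ∀ t, ‖(a t : ℂ)‖ ≤ B := fun t => by
    rw [Complex.norm_real, Real.norm_of_nonneg (ha0 t)]; exact hB t
  have he : Measurable ((↑) : ℝ → UnitAddCircle) := AddCircle.measurable_mk'
  have hi : ∀ ψ : L2R, Integrable (fun ξ : ℝ => ‖ψ ξ‖ ^ 2 * a (ξ : UnitAddCircle)) := fun ψ =>
    ((memLp_two_iff_integrable_sq_norm (Lp.memLp ψ).1).1 (Lp.memLp ψ)).mul_bdd
      (ha.comp he).aestronglyMeasurable (ae_of_all _ fun x => by
        rw [Real.norm_of_nonneg (ha0 _)]; exact hB _)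
  have h1 := integral_conj_mul_mul_periodic hbi (g := fun t => (a t : ℂ))
    (Complex.measurable_ofReal.comp ha) haB
  have h2 : ∫ t, a t = ‖∫ t, (a t : ℂ)‖ := by
    rw [show ∫ t, (a t : ℂ) = ((∫ t, a t : ℝ) : ℂ) from integral_ofReal, Complex.norm_real,
      Real.norm_of_nonneg (integral_nonneg ha0)]
  have h3 : ∫ t, a t ≤ C / 2 * (∫ ξ : ℝ, ‖(𝓕 φ : L2R) ξ‖ ^ 2 * a (ξ : UnitAddCircle)) +
      C⁻¹ / 2 * ∫ ξ : ℝ, ‖(𝓕 φ' : L2R) ξ‖ ^ 2 * a (ξ : UnitAddCircle) := by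
    rw [h2, ← h1, ← integral_const_mul, ← integral_const_mul,
      ← integral_add ((hi _).const_mul _) ((hi _).const_mul _)]
    refine norm_integral_le_of_norm_le (((hi _).const_mul _).add ((hi _).const_mul _))
      (ae_of_all _ fun ξ => ?_)
    simp only [norm_mul, RCLike.norm_conj, Complex.norm_real, Real.norm_of_nonneg (ha0 _)]
    set u := ‖(𝓕 φ : L2R) ξ‖
    set v := ‖(𝓕 φ' : L2R) ξ‖
    have h4 : u * v ≤ C / 2 * u ^ 2 + C⁻¹ / 2 * v ^ 2 := by
      have h5 : 0 ≤ C⁻¹ / 2 * (C * u - v) ^ 2 := by positivity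
      have h6 : C⁻¹ / 2 * (C * u - v) ^ 2 = C / 2 * u ^ 2 + C⁻¹ / 2 * v ^ 2 - u * v := by
        field_simp
        ring
      linarith
    calc u * v * a (ξ : UnitAddCircle) ≤ _ := mul_le_mul_of_nonneg_right h4 (ha0 _)
      _ = _ := by ring
  have h4 := hC a ha ha0 ⟨B, hB⟩
  have h5 : C⁻¹ / 2 * ∫ ξ : ℝ, ‖(𝓕 φ' : L2R) ξ‖ ^ 2 * a (ξ : UnitAddCircle) ≤ (∫ t, a t) / 2 := by
    calc _ ≤ C⁻¹ / 2 * (C * ∫ t, a t) := by gcongr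
      _ = _ := by field_simp
  linarith

theorem Biorthogonal.symm {φ φ' : L2R} (h : Biorthogonal φ φ') : Biorthogonal φ' φ := by
  intro j k
  rw [← inner_conj_symm, h k j]
  by_cases hjk : j = k
  · simp [hjk]
  · simp [hjk, Ne.symm hjk]

/-! ### The circle group and the additive circle -/

/-- The parametrization `t ↦ e^{-2πit}` of the circle group by the additive circle. -/
def freqCircle (t : UnitAddCircle) : Circle := AddCircle.toCircle (-t)

theorem continuous_freqCircle : Continuous freqCircle :=
  AddCircle.continuous_toCircle.comp continuous_neg

theorem freqCircle_coe (x : ℝ) : freqCircle (x : UnitAddCircle) = Circle.exp (-(2 * π * x)) := by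
  rw [freqCircle, ← AddCircle.coe_neg, AddCircle.toCircle_apply_mk, div_one, mul_neg]

theorem freqCircle_bijective : Function.Bijective freqCircle := by
  refine ⟨(AddCircle.injective_toCircle one_ne_zero).comp neg_injective, fun z => ?_⟩
  refine ⟨-(AddCircle.homeomorphCircle one_ne_zero).symm z, ?_⟩
  rw [freqCircle, neg_neg, ← AddCircle.homeomorphCircle_apply one_ne_zero,
    Homeomorph.apply_symm_apply]

theorem measurableEmbedding_freqCircle : MeasurableEmbedding freqCircle :=
  (continuous_freqCircle.isClosedEmbedding freqCircle_bijective.1).measurableEmbedding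

/-- The image measure is translation invariant with total mass 1, so uniqueness of Haar measure
identifies it. -/
theorem measurePreserving_freqCircle : MeasurePreserving freqCircle volume haarCircle := by
  have hm := continuous_freqCircle.measurable
  refine ⟨hm, ?_⟩
  have : (Measure.map freqCircle volume).IsMulLeftInvariant := by
    refine ⟨fun g => ?_⟩
    obtain ⟨s, rfl⟩ := freqCircle_bijective.2 g
    rw [Measure.map_map (by fun_prop) hm]
    have h : (fun x => freqCircle s * x) ∘ freqCircle = freqCircle ∘ fun t => s + t := by
      funext t
      simp [freqCircle, add_comm, AddCircle.toCircle_add]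
    rw [h, ← Measure.map_map hm (by fun_prop), map_add_left_eq_self]
  have : IsFiniteMeasure (Measure.map freqCircle volume) :=
    Measure.isFiniteMeasure_map volume freqCircle
  have h := Measure.haarMeasure_unique (Measure.map freqCircle volume) ⊤
  rw [h, haarCircle, TopologicalSpace.PositiveCompacts.coe_top,
    Measure.map_apply hm MeasurableSet.univ, Set.preimage_univ, UnitAddCircle.measure_univ, one_smul]

theorem exists_measurable_bounded_rep {f : Circle → ℂ} (hf : MemLp f ∞ haarCircle) :
    ∃ (M : UnitAddCircle → ℂ) (K : ℝ), Measurable M ∧ (∀ t, ‖M t‖ ≤ K) ∧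
      ∀ᵐ t, M t = f (freqCircle t) := by
  have h := hf.comp_measurePreserving measurePreserving_freqCircle
  set K : ℝ := (eLpNormEssSup (f ∘ freqCircle) volume).toReal with hK
  have hfin : eLpNormEssSup (f ∘ freqCircle) volume ≠ ∞ := by
    rw [← eLpNorm_exponent_top]; exact h.2.ne
  have hm := h.1.stronglyMeasurable_mk.measurable
  -- Setting the representative to 0 on the null set where it exceeds the essential supremum makes
  -- the bound hold everywhere.
  refine ⟨fun t => if ‖h.1.mk _ t‖ ≤ K then h.1.mk _ t else 0, K,
    Measurable.ite (measurableSet_le hm.norm measurable_const) hm measurable_const,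
    fun t => ?_, ?_⟩
  · dsimp only
    split_ifs with ht
    · exact ht
    · rw [norm_zero]; exact ENNReal.toReal_nonneg
  · filter_upwards [h.1.ae_eq_mk, ae_le_eLpNormEssSup (f := f ∘ freqCircle) (μ := volume)]
      with t h1 h2
    have h3 : ‖h.1.mk _ t‖ ≤ K := by
      rw [← h1, hK, ← toReal_enorm]
      exact ENNReal.toReal_mono hfin h2
    rw [if_pos h3, ← h1]
    rfl

theorem ruelle_freqCircle {N : ℕ} (hN : 0 < N) (m m' f : Circle → ℂ) (x : ℝ) :
    ruelle N m m' f (freqCircle (x : UnitAddCircle)) =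
      (1 / (N : ℂ)) * ∑ l ∈ Finset.range N,
        conj (m (freqCircle ((x + l) / N : ℝ))) * m' (freqCircle ((x + l) / N : ℝ)) *
          f (freqCircle ((x + l) / N : ℝ)) := by
  have hN' : (N : ℝ) ≠ 0 := by positivity
  set r : ℕ → Circle := fun l => freqCircle ((x + l) / N : ℝ) with hr
  have hset : {w : Circle | w ^ N = freqCircle (x : UnitAddCircle)} =
      r '' (Finset.range N : Set ℕ) := by
    ext w
    simp only [Set.mem_ofPred_eq, Set.mem_image, Finset.coe_range, Set.mem_Iio]
    constructor
    · intro hw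
      obtain ⟨u, rfl⟩ := Circle.exp_surjective w
      rw [freqCircle_coe, ← Circle.exp_natCast_mul, Circle.exp_eq_exp] at hw
      obtain ⟨k, hk⟩ := hw
      -- Here Nu = -2πx + 2πk, so u = -2π(x - k)/N and the index of the root is -k modulo N.
      refine ⟨((-k) % (N : ℤ)).toNat, ?_, ?_⟩
      · have := Int.emod_lt_of_pos (-k) (b := N) (by exact_mod_cast hN)
        have := Int.emod_nonneg (-k) (b := N) (by exact_mod_cast hN.ne')
        lia
      · simp only [hr]
        rw [freqCircle_coe, Circle.exp_eq_exp]
        have h1 : ((((-k) % (N : ℤ)).toNat : ℤ) : ℝ) = (((-k) % (N : ℤ) : ℤ) : ℝ) := by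
          rw [Int.toNat_of_nonneg (Int.emod_nonneg _ (by exact_mod_cast hN.ne'))]
        have h2 : (((-k) % (N : ℤ) : ℤ) : ℝ) + N * (((-k) / (N : ℤ) : ℤ) : ℝ) = -k := by
          exact_mod_cast Int.emod_add_mul_ediv (-k) N
        rw [Int.cast_natCast] at h1
        refine ⟨(-k) / (N : ℤ), ?_⟩
        rw [h1, eq_sub_of_add_eq h2]
        field_simp
        linear_combination -hk
    · rintro ⟨l, -, rfl⟩
      simp only [hr]
      rw [freqCircle_coe, freqCircle_coe, ← Circle.exp_natCast_mul, Circle.exp_eq_exp]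
      refine ⟨-l, ?_⟩
      push_cast
      field_simp
      ring
  have hinj : Set.InjOn r (Finset.range N) := by
    intro a ha b hb hab
    simp only [hr, freqCircle_coe, Circle.exp_eq_exp] at hab
    obtain ⟨k, hk⟩ := hab
    have hk' : (b : ℝ) - a = N * k := by
      field_simp at hk
      linear_combination hk
    have hk2 : (b : ℤ) - a = N * k := by exact_mod_cast hk'
    simp only [Finset.coe_range, Set.mem_Iio] at ha hb
    have h3 : (b : ℤ) - a = 0 := Int.eq_zero_of_abs_lt_dvd ⟨k, hk2⟩ (by rw [abs_lt]; lia)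
    lia
  rw [ruelle, hset, finsum_mem_image hinj, finsum_mem_coe_finset]

/-! ### Invariant functions of the transfer operator -/

theorem ae_scaling {N : ℕ} (hN : 0 < N) {m : Circle → ℂ} {φ : L2R}
    (h : IsScalingFunction N m φ) {M : UnitAddCircle → ℂ} (hM : ∀ᵐ t, M t = m (freqCircle t)) :
    ∀ᵐ ξ : ℝ, ((√(N : ℝ) : ℝ) : ℂ) * (𝓕 φ : L2R) (N * ξ) =
      M (ξ : UnitAddCircle) * (𝓕 φ : L2R) ξ := by
  filter_upwards [h.scaling, fourier_dilation hN φ, quasiMeasurePreserving_unitAddCircle_mk.ae hM]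
    with ξ h1 h2 h3
  rw [← h2, h1, h3, atFreq, freqCircle_coe]

/-- The weak form of R1 = 1. Both sides lift to the line with weight conj(φ̂)φ̂'. The scaling
equations turn the filters into the same weight at Nξ, and √N·√N cancels the Jacobian. -/
theorem integral_comp_nsmul_mul_weight {N : ℕ} (hN : 0 < N) {φ φ' : L2R}
    (hbi : Biorthogonal φ φ') {M M' : UnitAddCircle → ℂ} (hM : Measurable M) (hM' : Measurable M')
    {K : ℝ} (hMK : ∀ t, ‖M t‖ ≤ K) (hMK' : ∀ t, ‖M' t‖ ≤ K)
    (hscal : ∀ᵐ ξ : ℝ, ((√(N : ℝ) : ℝ) : ℂ) * (𝓕 φ : L2R) (N * ξ) =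
      M (ξ : UnitAddCircle) * (𝓕 φ : L2R) ξ)
    (hscal' : ∀ᵐ ξ : ℝ, ((√(N : ℝ) : ℝ) : ℂ) * (𝓕 φ' : L2R) (N * ξ) =
      M' (ξ : UnitAddCircle) * (𝓕 φ' : L2R) ξ)
    {g : UnitAddCircle → ℂ} (hg : Measurable g) {B : ℝ} (hB : ∀ t, ‖g t‖ ≤ B) :
    ∫ t, g (N • t) * (conj (M t) * M' t) = ∫ t, g t := by
  have hN' : (0 : ℝ) < N := by positivity
  have hconj : Measurable (fun z : ℂ => conj z) := Complex.continuous_conj.measurable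
  have hK0 : 0 ≤ K := (norm_nonneg _).trans (hMK 0)
  have hB0 : 0 ≤ B := (norm_nonneg _).trans (hB 0)
  rw [← integral_conj_mul_mul_periodic hbi (g := fun t => g (N • t) * (conj (M t) * M' t))
      ((hg.comp (continuous_nsmul N).measurable).mul ((hconj.comp hM).mul hM')) (K := B * (K * K))
      (fun t => by
        simp only [norm_mul, RCLike.norm_conj]
        gcongr
        exacts [hB _, hMK _, hMK' _]),
    ← integral_conj_mul_mul_periodic hbi hg hB]
  have h := Measure.integral_comp_mul_left (fun ξ : ℝ =>
    conj ((𝓕 φ : L2R) ξ) * (𝓕 φ' : L2R) ξ * g (ξ : UnitAddCircle)) (N : ℝ)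
  rw [abs_of_pos (by positivity), eq_inv_smul_iff₀ hN'.ne', ← integral_smul] at h
  rw [← h]
  refine integral_congr_ae ?_
  filter_upwards [hscal, hscal'] with ξ h1 h2
  have h3 : ((N * ξ : ℝ) : UnitAddCircle) = N • (ξ : UnitAddCircle) := by
    rw [← nsmul_eq_mul, AddCircle.coe_nsmul]
  have h4 := congrArg conj h1
  simp only [map_mul, Complex.conj_ofReal] at h4
  have h5 : ((√(N : ℝ) : ℝ) : ℂ) * ((√(N : ℝ) : ℝ) : ℂ) = N := by
    rw [← Complex.ofReal_mul, Real.mul_self_sqrt hN'.le, Complex.ofReal_natCast]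
  rw [h3, Complex.real_smul, Complex.ofReal_natCast, ← h5]
  linear_combination -(g (N • (ξ : UnitAddCircle)) * M' ξ * (𝓕 φ' : L2R) ξ) * h4 -
    (g (N • (ξ : UnitAddCircle)) * ((√(N : ℝ) : ℝ) : ℂ) * conj ((𝓕 φ : L2R) (N * ξ))) * h2

theorem ae_forall_translate_div {p : UnitAddCircle → Prop} (hp : ∀ᵐ t, p t) {N : ℕ} (hN : 0 < N) :
    ∀ᵐ x : ℝ, ∀ l : ℕ, p (((x + l) / N : ℝ) : UnitAddCircle) := by
  refine ae_all_iff.2 fun l => ?_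
  have hN' : (0 : ℝ) < (N : ℝ)⁻¹ := by positivity
  filter_upwards [(quasiMeasurePreserving_affine hN' ((N : ℝ)⁻¹ * l)).ae
    (quasiMeasurePreserving_unitAddCircle_mk.ae hp)] with x hx
  rwa [← mul_add, inv_mul_eq_div] at hx

theorem ae_of_ae_coe {p : UnitAddCircle → Prop}
    (hp : ∀ᵐ x ∂(volume.restrict (Set.Ioc (0 : ℝ) 1)), p ((x : ℝ) : UnitAddCircle)) : ∀ᵐ t, p t := by
  have h := (AddCircle.measurePreserving_equivIoc (T := 1) (a := 0)).quasiMeasurePreserving.ae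
    (p := fun y : Set.Ioc (0 : ℝ) (0 + 1) => p ((y : ℝ) : UnitAddCircle)) (by
      rw [← (MeasurableEmbedding.subtype_coe measurableSet_Ioc).ae_map_iff
        (p := fun y : ℝ => p (y : UnitAddCircle)), map_comap_subtype_coe measurableSet_Ioc,
        zero_add]
      exact hp)
  filter_upwards [h] with t ht
  have : ((AddCircle.equivIoc 1 0 t : ℝ) : UnitAddCircle) = t :=
    (AddCircle.equivIoc 1 0).symm_apply_apply t
  rwa [this] at ht

/-- The average of `conj M · M'` over the `N` preimages of a point is `1` almost everywhere. -/
theorem ae_average_weight_eq_one {N : ℕ} (hN : 0 < N) {M M' : UnitAddCircle → ℂ}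
    (hM : Measurable M) (hM' : Measurable M') {K : ℝ} (hMK : ∀ t, ‖M t‖ ≤ K)
    (hMK' : ∀ t, ‖M' t‖ ≤ K)
    (h : ∀ g : UnitAddCircle → ℂ, Measurable g → (∃ B : ℝ, ∀ t, ‖g t‖ ≤ B) →
      ∫ t, g (N • t) * (conj (M t) * M' t) = ∫ t, g t) :
    ∀ᵐ x ∂(volume.restrict (Set.Ioc (0 : ℝ) 1)),
      (1 / (N : ℂ)) * ∑ l ∈ Finset.range N,
        conj (M ((x + l) / N : ℝ)) * M' ((x + l) / N : ℝ) = 1 := by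
  have he : Measurable ((↑) : ℝ → UnitAddCircle) := AddCircle.measurable_mk'
  have hconj : Measurable (fun z : ℂ => conj z) := Complex.continuous_conj.measurable
  have hK0 : 0 ≤ K := (norm_nonneg _).trans (hMK 0)
  -- Composing with the representative in (0, 1] makes the average a function on the circle without
  -- checking its periodicity. It is then compared with 1 by testing against indicators.
  set s : UnitAddCircle → ℝ := fun t => (AddCircle.measurableEquivIoc 1 0 t : ℝ) with hs
  have hsm : Measurable s := measurable_subtype_coe.comp (AddCircle.measurableEquivIoc 1 0).measurable
  have hsx : ∀ x : ℝ, x ∈ Set.Ioc (0 : ℝ) 1 → s (x : UnitAddCircle) = x := fun x hx => by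
    have := AddCircle.equivIoc_coe_eq (p := (1 : ℝ)) (a := 0) (x := x) (by simpa using hx)
    exact congrArg Subtype.val this
  set r : ℝ → ℂ := fun x => (1 / (N : ℂ)) * ∑ l ∈ Finset.range N,
    conj (M ((x + l) / N : ℝ)) * M' ((x + l) / N : ℝ) with hr
  have hrm : Measurable r := by
    refine measurable_const.mul (Finset.measurable_fun_sum _ fun l _ => ?_)
    have h1 : Measurable fun x : ℝ => (((x + l) / N : ℝ) : UnitAddCircle) := he.comp (by fun_prop)
    exact (hconj.comp (hM.comp h1)).mul (hM'.comp h1)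
  have hrb : ∀ x, ‖r x‖ ≤ ‖1 / (N : ℂ)‖ * ∑ l ∈ Finset.range N, K * K := fun x => by
    rw [hr, norm_mul]
    refine mul_le_mul_of_nonneg_left ((norm_sum_le _ _).trans (Finset.sum_le_sum fun l _ => ?_))
      (norm_nonneg _)
    rw [norm_mul, RCLike.norm_conj]
    exact mul_le_mul (hMK _) (hMK' _) (norm_nonneg _) hK0
  have hri : Integrable (fun t => r (s t)) (volume : Measure UnitAddCircle) :=
    Integrable.of_bound (hrm.comp hsm).aestronglyMeasurable _ (ae_of_all _ fun t => hrb _)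
  have hae : (fun t => r (s t)) =ᵐ[(volume : Measure UnitAddCircle)] fun _ => (1 : ℂ) := by
    refine hri.ae_eq_of_forall_setIntegral_eq _ _ (integrable_const _) fun S hS _ => ?_
    set g : UnitAddCircle → ℂ := S.indicator fun _ => 1 with hg
    have hgm : Measurable g := measurable_const.indicator hS
    have hgb : ∀ t, ‖g t‖ ≤ max 1 (K * K) := fun t =>
      (norm_indicator_le_norm_self _ t).trans (by simp)
    have h1 := h g hgm ⟨_, hgb⟩
    rw [integral_comp_nsmul_mul (V := fun t => conj (M t) * M' t) hN hgm
      ((hconj.comp hM).mul hM') hgb (fun t => ?_)] at h1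
    · have h2 := UnitAddCircle.intervalIntegral_preimage 0 (fun t => g t * r (s t))
      rw [zero_add] at h2
      have h3 : ∫ x in (0 : ℝ)..1, g (x : UnitAddCircle) * r (s (x : UnitAddCircle)) =
          ∫ x in (0 : ℝ)..1, g (x : UnitAddCircle) * r x := by
        refine intervalIntegral.integral_congr_ae (ae_of_all _ fun x hx => ?_)
        rw [Set.uIoc_of_le zero_le_one] at hx
        rw [hsx x hx]
      rw [← integral_indicator hS, ← integral_indicator hS, ← hg, ← h1]
      refine Eq.trans ?_ (h2.symm.trans h3)
      refine integral_congr_ae (ae_of_all _ fun t => ?_)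
      by_cases ht : t ∈ S <;> simp [hg, ht]
    · refine le_trans ?_ (le_max_right _ _)
      rw [norm_mul, RCLike.norm_conj]
      exact mul_le_mul (hMK _) (hMK' _) (norm_nonneg _) hK0
  have hae' := (UnitAddCircle.measurePreserving_mk 0).quasiMeasurePreserving.ae hae
  rw [zero_add] at hae'
  filter_upwards [hae', ae_restrict_mem measurableSet_Ioc] with x h1 hx
  rwa [hsx x hx] at h1

end BiorthogonalRuelle

end

/-! ### Invariant functions continuous at 1 are the constants -/

theorem corollary6 (N : ℕ) (hN : 2 ≤ N)
    (m₀ m₀' : Circle → ℂ) (φ φ' : BiorthogonalRuelle.L2R)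
    (hφ : BiorthogonalRuelle.IsScalingFunction N m₀ φ)
    (hφ' : BiorthogonalRuelle.IsScalingFunction N m₀' φ')
    (hsupp : BiorthogonalRuelle.IsCompactlySupported φ)
    (hsupp' : BiorthogonalRuelle.IsCompactlySupported φ')
    (hbi : BiorthogonalRuelle.Biorthogonal φ φ')
    (hm₀ : BiorthogonalRuelle.IsLowPass N m₀)
    (hm₀' : BiorthogonalRuelle.IsLowPass N m₀')
    (h₀ : Circle → ℂ) (hh₀ : MemLp h₀ ∞ BiorthogonalRuelle.haarCircle)
    (hcont : ContinuousAt h₀ 1) :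
    BiorthogonalRuelle.ruelle N m₀ m₀' h₀ =ᵐ[BiorthogonalRuelle.haarCircle] h₀ ↔
      ∃ c : ℂ, h₀ =ᵐ[BiorthogonalRuelle.haarCircle] fun _ => c := by
  open BiorthogonalRuelle in
  have hN0 : 0 < N := by lia
  have hconj : Measurable (fun z : ℂ => conj z) := Complex.continuous_conj.measurable
  obtain ⟨M, KM, hM, hMK, hMe⟩ := exists_measurable_bounded_rep hφ.filter_memLp
  obtain ⟨M', KM', hM', hMK', hMe'⟩ := exists_measurable_bounded_rep hφ'.filter_memLp
  obtain ⟨H, KH, hH, hHK, hHe⟩ := exists_measurable_bounded_rep hh₀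
  -- One bound for both filters, for `H` and for H - h₀(1).
  set K : ℝ := max (max KM KM') (KH + ‖h₀ 1‖) with hKdef
  have hMK2 : ∀ t, ‖M t‖ ≤ K := fun t =>
    (hMK t).trans ((le_max_left _ _).trans (le_max_left _ _))
  have hMK2' : ∀ t, ‖M' t‖ ≤ K := fun t =>
    (hMK' t).trans ((le_max_right _ _).trans (le_max_left _ _))
  have hK0 : 0 ≤ K := (norm_nonneg _).trans (hMK2 0)
  have hHK2 : ∀ t, ‖H t‖ ≤ K := fun t =>
    (hHK t).trans ((le_add_of_nonneg_right (norm_nonneg _)).trans (le_max_right _ _))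
  have hscal := ae_scaling hN0 hφ hMe
  have hscal' := ae_scaling hN0 hφ' hMe'
  have hone : ∀ g : UnitAddCircle → ℂ, Measurable g → (∃ B : ℝ, ∀ t, ‖g t‖ ≤ B) →
      ∫ t, g (N • t) * (conj (M t) * M' t) = ∫ t, g t := fun g hg ⟨B, hB⟩ =>
    integral_comp_nsmul_mul_weight hN0 hbi hM hM' hMK2 hMK2' hscal hscal' hg hB
  have hruelle : ∀ᵐ x : ℝ, ruelle N m₀ m₀' h₀ (freqCircle (x : UnitAddCircle)) =
      (1 / (N : ℂ)) * ∑ l ∈ Finset.range N, conj (M ((x + l) / N : ℝ)) * M' ((x + l) / N : ℝ) *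
        H ((x + l) / N : ℝ) := by
    filter_upwards [ae_forall_translate_div hMe hN0, ae_forall_translate_div hMe' hN0,
      ae_forall_translate_div hHe hN0] with x h1 h2 h3
    rw [ruelle_freqCircle hN0]
    simp only [h1, h2, h3]
  constructor
  · intro hinv
    refine ⟨h₀ 1, ?_⟩
    obtain ⟨C, hC⟩ := exists_integral_le_integral_normSq_mul hbi hsupp'
    obtain ⟨C', hC'⟩ := exists_integral_le_integral_normSq_mul hbi.symm hsupp
    have hinv' := quasiMeasurePreserving_unitAddCircle_mk.ae
      (measurePreserving_freqCircle.quasiMeasurePreserving.ae hinv)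
    have hHx := quasiMeasurePreserving_unitAddCircle_mk.ae hHe
    have hDm : Measurable fun t => H t - h₀ 1 := hH.sub_const _
    have hDK : ∀ t, ‖H t - h₀ 1‖ ≤ K := fun t => (norm_sub_le _ _).trans
      ((add_le_add_left (hHK t) _).trans (le_max_right _ _))
    have hbd : ∀ {g : UnitAddCircle → ℂ} {B : ℝ}, Measurable g → (∀ t, ‖g t‖ ≤ B) →
        Integrable g := fun hg hB => Integrable.of_bound hg.aestronglyMeasurable _ (ae_of_all _ hB)
    have hD := ae_eq_zero_of_invariant (H := fun t => H t - h₀ 1) hN hM hM' hDm hMK2 hMK2' hDK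
      (Lp.memLp _) (Lp.memLp _) hscal hscal' hC hC' ?_ ?_
    · have h1 : ∀ᵐ t, h₀ (freqCircle t) = h₀ 1 := by
        filter_upwards [hD, hHe] with t h1 h2
        rw [← h2]
        exact sub_eq_zero.1 h1
      rw [← measurePreserving_freqCircle.map_eq]
      exact measurableEmbedding_freqCircle.ae_map_iff.2 h1
    · have h1 : ∀ᵐ x : ℝ, ∀ n : ℕ, H ((x / (N : ℝ) ^ n : ℝ) : UnitAddCircle) =
          h₀ (freqCircle ((x / (N : ℝ) ^ n : ℝ) : UnitAddCircle)) := by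
        refine ae_all_iff.2 fun n => ?_
        filter_upwards [(quasiMeasurePreserving_affine (s := ((N : ℝ) ^ n)⁻¹)
          (by positivity) 0).ae hHx] with x hx
        rwa [add_zero, inv_mul_eq_div] at hx
      filter_upwards [h1] with x hx
      simp only [hx]
      have h2 : Tendsto (fun n : ℕ => x / (N : ℝ) ^ n) atTop (𝓝 0) :=
        tendsto_const_nhds.div_atTop (tendsto_pow_atTop_atTop_of_one_lt (by exact_mod_cast hN))
      have h3 : Tendsto (fun n : ℕ => freqCircle ((x / (N : ℝ) ^ n : ℝ) : UnitAddCircle)) atTop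
          (𝓝 1) := by
        have hc : Continuous fun y : ℝ => Circle.exp (-(2 * π * y)) := by fun_prop
        have := (hc.tendsto 0).comp h2
        simp only [mul_zero, neg_zero, Circle.exp_zero] at this
        simpa only [freqCircle_coe, Function.comp_def] using this
      have h4 := (hcont.tendsto.comp h3).sub_const (h₀ 1)
      simpa using h4
    · intro g hg ⟨B, hB⟩
      have hB0 : 0 ≤ B := (norm_nonneg _).trans (hB 0)
      have hWm : Measurable fun t => conj (M t) * M' t * H t := ((hconj.comp hM).mul hM').mul hH
      have hgN : Measurable fun t => g (N • t) := hg.comp (continuous_nsmul N).measurable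
      have hW1 : ∀ t, ‖conj (M t) * M' t‖ ≤ K * K := fun t => by
        rw [norm_mul, RCLike.norm_conj]
        exact mul_le_mul (hMK2 _) (hMK2' _) (norm_nonneg _) hK0
      have hW : ∀ t, ‖conj (M t) * M' t * H t‖ ≤ K * K * K := fun t => by
        rw [norm_mul]
        exact mul_le_mul (hW1 _) (hHK2 _) (norm_nonneg _) (by positivity)
      have h1 : ∫ t, g (N • t) * (conj (M t) * M' t * H t) = ∫ t, g t * H t := by
        rw [integral_comp_nsmul_mul hN0 hg hWm (K := max B (K * K * K))
          (fun t => (hB t).trans (le_max_left _ _)) (fun t => (hW t).trans (le_max_right _ _))]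
        have h2 := UnitAddCircle.intervalIntegral_preimage 0 (fun t => g t * H t)
        rw [zero_add] at h2
        rw [← h2]
        refine intervalIntegral.integral_congr_ae ?_
        filter_upwards [hruelle, hinv', hHx] with x h3 h4 h5 _
        rw [← h3, h4, h5]
      have h2 := hone g hg ⟨B, hB⟩
      -- Invariance of the difference is the invariance of `H` minus h₀(1) times that of the
      -- constant 1.
      have h3 : ∀ t, g (N • t) * (conj (M t) * M' t * (H t - h₀ 1)) =
          g (N • t) * (conj (M t) * M' t * H t) - h₀ 1 * (g (N • t) * (conj (M t) * M' t)) :=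
        fun t => by ring
      have h4 : ∀ t, g t * (H t - h₀ 1) = g t * H t - h₀ 1 * g t := fun t => by ring
      simp only [h3, h4]
      rw [integral_sub, integral_sub, integral_const_mul, integral_const_mul, h1, h2]
      · exact hbd (hg.mul hH) (B := B * K) fun t => by
          rw [norm_mul]; exact mul_le_mul (hB _) (hHK2 _) (norm_nonneg _) hB0
      · exact (hbd hg hB).const_mul _
      · exact hbd (hgN.mul hWm) (B := B * (K * K * K)) fun t => by
          rw [norm_mul]; exact mul_le_mul (hB _) (hW _) (norm_nonneg _) hB0
      · refine (hbd (g := fun t => g (N • t) * (conj (M t) * M' t))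
          (hgN.mul ((hconj.comp hM).mul hM')) (B := B * (K * K)) fun t => ?_).const_mul _
        rw [norm_mul]; exact mul_le_mul (hB _) (hW1 _) (norm_nonneg _) hB0
  · rintro ⟨c, hc⟩
    have hc' := measurePreserving_freqCircle.quasiMeasurePreserving.ae hc
    have hHc : ∀ᵐ t, H t = c := by
      filter_upwards [hHe, hc'] with t h1 h2
      rw [h1, h2]
    rw [← measurePreserving_freqCircle.map_eq]
    refine measurableEmbedding_freqCircle.ae_map_iff.2 ?_
    -- For a constant c, Rc = c·R1, so only the average of the weight matters.
    have hr := ae_average_weight_eq_one hN0 hM hM' hMK2 hMK2' hone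
    refine ae_of_ae_coe ?_
    have h1 : ∀ᵐ x : ℝ, ruelle N m₀ m₀' h₀ (freqCircle (x : UnitAddCircle)) =
        ((1 / (N : ℂ)) * ∑ l ∈ Finset.range N,
          conj (M ((x + l) / N : ℝ)) * M' ((x + l) / N : ℝ)) * c := by
      filter_upwards [hruelle, ae_forall_translate_div hHc hN0] with x h1 h2
      simp only [h1, h2, mul_assoc, Finset.sum_mul]
    filter_upwards [hr, ae_restrict_of_ae h1, ae_restrict_of_ae
      (quasiMeasurePreserving_unitAddCircle_mk.ae hc')] with x h2 h3 h4
    rw [h3, h2, one_mul, h4]
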